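/- Let $K \subseteq \mathbb{C}$ be a number field, $K^c \subseteq \mathbb{C}$ its algebraic closure, $\Omega = \mathrm{Gal}(K^c/K)$, and let $G$ be a finite group of order $n$ and exponent $e$. Let $R_G$ be the group of virtual complex characters of $G$, let $\rho_G$ be the regular character, and let $A_G$ be the kernel of the homomorphism $\det$ from $R_G$ to the group of degree-one characters of $G$ that sends the character of a representation $T$ to $s \mapsto \det T(s)$. For a degree-one character $\psi$ of a finite group and an element $s$, let $\langle \psi, s\rangle \in \mathbb{Q}\cap[0,1)$ be defined by $\psi(s) = e^{2\pi i \langle\psi,s\rangle}$; for $\chi \in R_G$ and $s \in G$ let $\langle \chi, s\rangle = \langle \mathrm{res}_{\langle s\rangle}\chi, s\rangle$, extended linearly from the degree-one characters of the cyclic group $\langle s\rangle$. It depends only on the conjugacy class $\bar s$ of $s$. Let $\bar G$ be the set of conjugacy classes of $G$, and $\Theta_{\bar G}(\chi) = \sum_{\bar s \in \bar G} \langle \chi, s\rangle\, \bar s \in \mathbb{Q}\bar G$. Let $\kappa : \Omega \to (\mathbb{Z}/e\mathbb{Z})^\times$ be the cyclotomic character, $\omega(\zeta) = \zeta^{\kappa(\omega)}$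 for $\zeta^e = 1$, and let $\Omega$ act on $\bar G$ by $\bar s^{\,\omega} = \overline{s^{\kappa(\omega)^{-1}}}$. Let $S \subseteq G$ be a set of elements whose conjugacy classes form a set of representatives of the $\Omega$-orbits of $\bar G$ (exactly one element of $S$ for each orbit). For $s \in G$ let $K(\bar s) \subseteq K^c$ be the fixed field of the $\Omega$-stabilizer of $\bar s$. For an algebraic extension $L/K$ let $\mathbb{J}(L) = (L \otimes_K \mathbb{A}(K))^\times$, where $\mathbb{A}(K)$ is the adèle ring of $K$; so $\mathbb J(K)\subseteq\mathbb J(K(\bar s))\subseteq \mathbb{J}(K^c)$, and $N_{K(\bar s)/K} : \mathbb{J}(K(\bar s)) \to \mathbb{J}(K)$ is the norm. Let $h \in \mathbb{J}(K\bar\Lambda) = \mathrm{Hom}_\Omega(\mathbb{Z}\bar G, \mathbb{J}(K^c))$; then $h(\bar s) \in \mathbb{J}(K(\bar s))$ for every $s$. If $\rho_G \in A_G$, then $\Theta_{\bar G}(\rho_G) \in \mathbb{Z}\bar G$, the numbers $\frac{n}{m}\frac{m-1}{2}$ with $m \mid e$ are integers, and $$h(\Theta_{\bar G}(\rho_G))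 = \prod_{m \mid e} \Bigl( \prod_{s \in S,\ |s| = m} N_{K(\bar s)/K}(h(\bar s)) \Bigr)^{\frac{n}{m}\frac{m-1}{2}}.$$ In any case $2\rho_G \in A_G$, $\Theta_{\bar G}(2\rho_G) \in \mathbb{Z}\bar G$, and $$h(\Theta_{\bar G}(2\rho_G)) = \prod_{m \mid e} \Bigl( \prod_{s \in S,\ |s| = m} N_{K(\bar s)/K}(h(\bar s)) \Bigr)^{\frac{n}{m}(m-1)}.$$ -/

import Mathlib

open scoped TensorProduct

noncomputable section

namespace Stickelberger

/-! ### Characters and virtual characters -/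

section Characters

variable (G : Type*) [Group G]

/-- `χ : G → ℂ` is a character: the trace of a complex representation of `G` of some finite
degree `d`. -/
def IsCharacter (χ : G → ℂ) : Prop :=
  ∃ (d : ℕ) (T : Representation ℂ G (Fin d → ℂ)), χ = T.character

/-- The group `R_G` of virtual characters of `G`: all `ℤ`-linear combinations of characters. -/
def VirtualChar : Submodule ℤ (G → ℂ) :=
  Submodule.span ℤ {χ | IsCharacter G χ}

variable {G}

theorem isCharacter_character {V : Type*} [AddCommGroup V] [Module ℂ V] [FiniteDimensional ℂ V]
    (T : Representation ℂ G V) : IsCharacter G T.character := by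
  let b := (Module.finBasis ℂ V).equivFun
  refine ⟨Module.finrank ℂ V,
    (b.conjAlgEquiv ℂ : Module.End ℂ V →* Module.End ℂ _).comp T, ?_⟩
  funext g
  exact (LinearMap.trace_conj' (T g) b).symm

theorem character_mem {V : Type*} [AddCommGroup V] [Module ℂ V] [FiniteDimensional ℂ V]
    (T : Representation ℂ G V) : T.character ∈ VirtualChar G :=
  Submodule.subset_span (isCharacter_character T)

/-- The character of a finite-dimensional representation, as a virtual character. -/
def charOf {V : Type*} [AddCommGroup V] [Module ℂ V] [FiniteDimensional ℂ V]
    (T : Representation ℂ G V) : VirtualChar G :=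
  ⟨T.character, character_mem T⟩

theorem virtualChar_induction {p : VirtualChar G → Prop}
    (hc : ∀ (d : ℕ) (T : Representation ℂ G (Fin d → ℂ)), p (charOf T))
    (h0 : p 0) (ha : ∀ x y, p x → p y → p (x + y)) (hz : ∀ (n : ℤ) x, p x → p (n • x))
    (x : VirtualChar G) : p x := by
  obtain ⟨x, hx⟩ := x
  induction hx using Submodule.span_induction with
  | mem x h => obtain ⟨d, T, rfl⟩ := h; exact hc d T
  | zero => exact h0
  | add x y hx hy h1 h2 => exact ha _ _ h1 h2
  | smul n x hx h => exact hz n _ h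

/-- The one-dimensional representation attached to a homomorphism `ψ : G → ℂˣ`. -/
def linRep (ψ : G →* ℂˣ) : Representation ℂ G ℂ :=
  ((Module.toModuleEnd ℂ ℂ : ℂ →+* Module.End ℂ ℂ) : ℂ →* Module.End ℂ ℂ).comp
    ((Units.coeHom ℂ).comp ψ)

theorem linRep_apply (ψ : G →* ℂˣ) (g : G) (z : ℂ) : linRep ψ g z = (ψ g : ℂ) * z := rfl

/-- A character of degree one, as a virtual character. -/
def linChar (ψ : G →* ℂˣ) : VirtualChar G := charOf (linRep ψ)

theorem linChar_apply (ψ : G →* ℂˣ) (g : G) : (linChar ψ : G → ℂ) g = ψ g := by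
  have : linRep ψ g = (ψ g : ℂ) • LinearMap.id := by ext; simp [linRep_apply]
  simp [linChar, charOf, Representation.character, this]

/-- Restriction of virtual characters to a subgroup. -/
def res (H : Subgroup G) : VirtualChar G →ₗ[ℤ] VirtualChar H :=
  (LinearMap.funLeft ℤ ℂ (H.subtype : H → G)).restrict (by
    intro x hx
    have := Submodule.mem_map_of_mem (f := LinearMap.funLeft ℤ ℂ (H.subtype : H → G)) hx
    refine (Submodule.map_span_le _ _ _).2 ?_ this
    rintro _ ⟨d, T, rfl⟩
    exact character_mem (V := Fin d → ℂ) (MonoidHom.comp T H.subtype))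

theorem res_apply (H : Subgroup G) (χ : VirtualChar G) (t : H) :
    (res H χ : H → ℂ) t = (χ : G → ℂ) t := rfl

variable [Finite G]

theorem exists_eigenbasis {V : Type*} [AddCommGroup V] [Module ℂ V] [FiniteDimensional ℂ V]
    (T : Representation ℂ G V) (s : G) :
    ∃ (b : Module.Basis (Fin (Module.finrank ℂ V)) ℂ V) (l : Fin (Module.finrank ℂ V) → ℂˣ),
      (∀ i, T s (b i) = (l i : ℂ) • b i) ∧ ∀ i, l i ^ orderOf s = 1 := by
  have hs : (T s) ^ orderOf s = 1 := by rw [← map_pow, pow_orderOf_eq_one, map_one]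
  have hss : Module.End.IsSemisimple (T s) := by
    refine Module.End.isSemisimple_of_squarefree_aeval_eq_zero
      (p := (Polynomial.X ^ orderOf s - 1 : Polynomial ℂ)) ?_ (by
        rw [map_sub, map_pow, Polynomial.aeval_X, map_one]; exact sub_eq_zero.2 hs)
    exact (Polynomial.X_pow_sub_one_separable_iff.2
      (by exact_mod_cast (orderOf_pos s).ne')).squarefree
  have htop : ⊤ ≤ Submodule.span ℂ {v : V | ∃ μ : ℂ, T s v = μ • v} := by
    rw [← hss.iSup_eigenspace_eq_top, iSup_le_iff]
    intro μ v hv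
    exact Submodule.subset_span ⟨μ, Module.End.mem_eigenspace_iff.1 hv⟩
  let b0 := Module.Basis.ofSpan htop
  let b := b0.reindex ((Module.finBasis ℂ V).indexEquiv b0).symm
  have hb : ∀ i, ∃ μ : ℂ, T s (b i) = μ • b i := by
    intro i
    have h1 := Module.Basis.ofSpan_subset htop ⟨((Module.finBasis ℂ V).indexEquiv b0) i, rfl⟩
    simpa [b, b0] using h1
  choose μ hμ using hb
  have hpow : ∀ i (k : ℕ), ((T s) ^ k) (b i) = μ i ^ k • b i := by
    intro i k
    induction k with
    | zero => simp
    | succ k ih => rw [pow_succ', Module.End.mul_apply, ih, map_smul, hμ, smul_smul, pow_succ]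
  have hone : ∀ i, μ i ^ orderOf s = 1 := by
    intro i
    have h1 := hpow i (orderOf s)
    rw [hs, Module.End.one_apply] at h1
    have h2 : ((1 : ℂ) - μ i ^ orderOf s) • b i = 0 := by rw [sub_smul, ← h1, one_smul, sub_self]
    rcases smul_eq_zero.1 h2 with h | h
    · exact (sub_eq_zero.1 h).symm
    · exact absurd h (b.ne_zero i)
  have hne : ∀ i, μ i ≠ 0 := by
    intro i h
    have := hone i
    rw [h, zero_pow (orderOf_pos s).ne'] at this
    exact zero_ne_one this
  exact ⟨b, fun i => Units.mk0 (μ i) (hne i), hμ, fun i => Units.ext (hone i)⟩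

theorem trace_of_eigenbasis {V : Type*} [AddCommGroup V] [Module ℂ V] {d : ℕ}
    (b : Module.Basis (Fin d) ℂ V) (f : Module.End ℂ V) (l : Fin d → ℂ)
    (h : ∀ i, f (b i) = l i • b i) :
    LinearMap.trace ℂ V f = ∑ i, l i := by
  rw [LinearMap.trace_eq_matrix_trace ℂ b, Matrix.trace]
  refine Finset.sum_congr rfl fun i _ => ?_
  simp [LinearMap.toMatrix_apply, h]

theorem det_of_eigenbasis {V : Type*} [AddCommGroup V] [Module ℂ V] {d : ℕ}
    (b : Module.Basis (Fin d) ℂ V) (f : Module.End ℂ V) (l : Fin d → ℂ)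
    (h : ∀ i, f (b i) = l i • b i) :
    LinearMap.det f = ∏ i, l i := by
  have : LinearMap.toMatrix b b f = Matrix.diagonal l := by
    ext i j
    by_cases hij : i = j
    · subst hij; simp [LinearMap.toMatrix_apply, h]
    · simp [LinearMap.toMatrix_apply, h, hij]
  rw [← LinearMap.det_toMatrix b, this, Matrix.det_diagonal]

/-- A character of a cyclic group is a sum of characters of degree one, read off from an
eigenbasis of a generator. -/
theorem charOf_eq_sum [IsCyclic G] {V : Type*} [AddCommGroup V] [Module ℂ V]
    (g : G) (hg : ∀ x, x ∈ Subgroup.zpowers g) {d : ℕ} [FiniteDimensional ℂ V]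
    (T : Representation ℂ G V)
    (b : Module.Basis (Fin d) ℂ V) (l : Fin d → ℂˣ)
    (h : ∀ i, T g (b i) = (l i : ℂ) • b i) (h1 : ∀ i, l i ^ orderOf g = 1) :
    charOf T = ∑ i, linChar (monoidHomOfForallMemZpowers hg (orderOf_dvd_of_pow_eq_one (h1 i))) := by
  apply Subtype.ext
  funext x
  obtain ⟨k, rfl⟩ := (mem_powers_iff_mem_zpowers.2 (hg x))
  have hpow : ∀ i (k : ℕ), (T (g ^ k)) (b i) = (l i : ℂ) ^ k • b i := by
    intro i k
    induction k with
    | zero => simp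
    | succ k ih =>
      rw [pow_succ', map_mul, Module.End.mul_apply, ih, map_smul, h, smul_smul, pow_succ]
  have : (charOf T : G → ℂ) (g ^ k) = ∑ i, (l i : ℂ) ^ k :=
    trace_of_eigenbasis b _ _ (fun i => hpow i k)
  simp only
  rw [this]
  simp [linChar_apply]

/-- For a finite cyclic group, the characters of degree one form a `ℤ`-basis of the group of
virtual characters. -/
def degOneBasis (C : Type*) [Group C] [Finite C] [IsCyclic C] :
    Module.Basis (C →* ℂˣ) ℤ (VirtualChar C) :=
  Module.Basis.mk (v := linChar)
    (by
      have h1 : LinearIndependent ℂ (fun f : C →* ℂ => (f : C → ℂ)) :=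
        linearIndependent_monoidHom C ℂ
      have h2 := (h1.restrict_scalars' ℤ).comp
        (fun ψ : C →* ℂˣ => (Units.coeHom ℂ).comp ψ) (by
          intro a b h
          ext x
          exact DFunLike.congr_fun h x)
      refine LinearIndependent.of_comp (VirtualChar C).subtype ?_
      convert! h2 using 1
      funext ψ x
      exact linChar_apply ψ x)
    (by
      obtain ⟨g, hg⟩ := IsCyclic.exists_generator (α := C)
      intro x _
      induction x using virtualChar_induction with
      | hc d T =>
        obtain ⟨b, l, h, h1⟩ := exists_eigenbasis T g
        rw [charOf_eq_sum g hg T b l h h1]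
        exact Submodule.sum_mem _ fun i _ => Submodule.subset_span ⟨_, rfl⟩
      | h0 => exact Submodule.zero_mem _
      | ha x y hx hy => exact Submodule.add_mem _ (hx trivial) (hy trivial)
      | hz n x hx => exact Submodule.smul_mem _ n (hx trivial))

theorem degOneBasis_apply (C : Type*) [Group C] [Finite C] [IsCyclic C] (ψ : C →* ℂˣ) :
    degOneBasis C ψ = linChar ψ := by
  simp [degOneBasis]

/-! ### The pairing -/

theorem exists_pairing_degOne (ψ : G →* ℂˣ) (s : G) :
    ∃ q : ℚ, 0 ≤ q ∧ q < 1 ∧ (ψ s : ℂ) = Complex.exp (2 * Real.pi * Complex.I * (q : ℂ)) := by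
  have h1 : ψ s ^ orderOf s = 1 := by rw [← map_pow, pow_orderOf_eq_one, map_one]
  have : NeZero (orderOf s) := ⟨(orderOf_pos s).ne'⟩
  obtain ⟨i, hi, h⟩ := (Complex.mem_rootsOfUnity (orderOf s) (ψ s)).1 h1
  have hp : (0 : ℚ) < orderOf s := by exact_mod_cast orderOf_pos s
  refine ⟨(i : ℚ) / orderOf s, by positivity, ?_, ?_⟩
  · rw [div_lt_one hp]; exact_mod_cast hi
  · rw [← h]; push_cast; rfl

/-- The rational number `⟨ψ, s⟩ ∈ [0, 1)` with `ψ(s) = exp (2πi⟨ψ, s⟩)`, for a character `ψ` of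
degree one. -/
def pairingDegOne (ψ : G →* ℂˣ) (s : G) : ℚ := (exists_pairing_degOne ψ s).choose

theorem pairingDegOne_spec (ψ : G →* ℂˣ) (s : G) :
    0 ≤ pairingDegOne ψ s ∧ pairingDegOne ψ s < 1 ∧
      (ψ s : ℂ) = Complex.exp (2 * Real.pi * Complex.I * (pairingDegOne ψ s : ℂ)) :=
  (exists_pairing_degOne ψ s).choose_spec

/-- The pairing `χ ↦ ⟨χ, s⟩` on virtual characters: restrict `χ` to the cyclic group `⟨s⟩`, and
extend `ψ ↦ ⟨ψ, s⟩` linearly from the characters `ψ` of degree one of `⟨s⟩`. -/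
def pairing (s : G) : VirtualChar G →ₗ[ℤ] ℚ :=
  ((degOneBasis (Subgroup.zpowers s)).constr ℤ
    fun ψ => pairingDegOne ψ ⟨s, Subgroup.mem_zpowers s⟩) ∘ₗ res (Subgroup.zpowers s)

theorem pairingDegOne_unique {C D : Type*} [Group C] [Finite C] [Group D] [Finite D]
    (ψ : C →* ℂˣ) (s : C) (φ : D →* ℂˣ) (t : D) (h : ψ s = φ t) :
    pairingDegOne ψ s = pairingDegOne φ t := by
  obtain ⟨a0, a1, ha⟩ := pairingDegOne_spec ψ s
  obtain ⟨b0, b1, hb⟩ := pairingDegOne_spec φ t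
  rw [h, hb, Complex.exp_eq_exp_iff_exists_int] at ha
  obtain ⟨n, hn⟩ := ha
  have hpi : (2 * Real.pi * Complex.I : ℂ) ≠ 0 := Complex.two_pi_I_ne_zero
  have h2 : (pairingDegOne φ t : ℂ) = (pairingDegOne ψ s : ℂ) + n := by
    apply mul_left_cancel₀ hpi
    rw [hn]; ring
  have h3 : pairingDegOne φ t = pairingDegOne ψ s + n := by exact_mod_cast h2
  have h4 : n = 0 := by
    have e1 : (n : ℚ) < 1 := by linarith
    have e2 : (-1 : ℚ) < n := by linarith
    have e3 : n < 1 := by exact_mod_cast e1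
    have e4 : -1 < n := by exact_mod_cast e2
    omega
  rw [h3, h4]; simp

theorem pairing_charOf {V : Type*} [AddCommGroup V] [Module ℂ V] [FiniteDimensional ℂ V]
    (T : Representation ℂ G V) (s : G) {d : ℕ} (b : Module.Basis (Fin d) ℂ V)
    (l : Fin d → ℂˣ) (h : ∀ i, T s (b i) = (l i : ℂ) • b i) (h1 : ∀ i, l i ^ orderOf s = 1) :
    ∃ ψ : Fin d → (Subgroup.zpowers s →* ℂˣ),
      (∀ i, ψ i ⟨s, Subgroup.mem_zpowers s⟩ = l i) ∧
      pairing s (charOf T) = ∑ i, pairingDegOne (ψ i) ⟨s, Subgroup.mem_zpowers s⟩ := by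
  have hg : ∀ x, x ∈ Subgroup.zpowers (⟨s, Subgroup.mem_zpowers s⟩ : Subgroup.zpowers s) := by
    rintro ⟨x, k, rfl⟩
    exact ⟨k, Subtype.ext (by simp)⟩
  have ho : orderOf (⟨s, Subgroup.mem_zpowers s⟩ : Subgroup.zpowers s) = orderOf s := by simp
  have h1' : ∀ i, l i ^ orderOf (⟨s, Subgroup.mem_zpowers s⟩ : Subgroup.zpowers s) = 1 := by
    rw [ho]; exact h1
  have hres : res (Subgroup.zpowers s) (charOf T) =
      charOf (V := V) (MonoidHom.comp T (Subgroup.zpowers s).subtype) := rfl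
  refine ⟨fun i => monoidHomOfForallMemZpowers hg (orderOf_dvd_of_pow_eq_one (h1' i)),
    fun i => monoidHomOfForallMemZpowers_apply_gen _ _, ?_⟩
  have h2 := charOf_eq_sum (V := V) (⟨s, Subgroup.mem_zpowers s⟩ : Subgroup.zpowers s) hg
    (MonoidHom.comp T (Subgroup.zpowers s).subtype) b l h h1'
  rw [pairing, LinearMap.comp_apply, hres, h2, map_sum]
  refine Finset.sum_congr rfl fun i _ => ?_
  rw [← degOneBasis_apply, Module.Basis.constr_basis]

theorem exp_pairing_charOf {V : Type*} [AddCommGroup V] [Module ℂ V] [FiniteDimensional ℂ V]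
    (T : Representation ℂ G V) (s : G) :
    Complex.exp (2 * Real.pi * Complex.I * (pairing s (charOf T) : ℂ)) = LinearMap.det (T s) := by
  obtain ⟨b, l, h, h1⟩ := exists_eigenbasis T s
  obtain ⟨ψ, hψ, hp⟩ := pairing_charOf T s b l h h1
  rw [det_of_eigenbasis b (T s) _ h, hp]
  push_cast
  rw [Finset.mul_sum, Complex.exp_sum]
  refine Finset.prod_congr rfl fun i _ => ?_
  rw [← hψ i]
  exact (pairingDegOne_spec _ _).2.2.symm

/-- `⟨χ, s⟩` depends only on the conjugacy class of `s`. -/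
theorem pairing_eq_of_isConj {s t : G} (hst : IsConj s t) : pairing s = pairing t := by
  obtain ⟨c, rfl⟩ := isConj_iff.1 hst
  ext χ
  induction χ using virtualChar_induction with
  | hc d T =>
    obtain ⟨b, l, h, h1⟩ := exists_eigenbasis T s
    obtain ⟨ψ, hψ, hp⟩ := pairing_charOf T s b l h h1
    have hc : T c⁻¹ ∘ₗ T c = LinearMap.id := by
      rw [← Module.End.mul_eq_comp, ← map_mul]; simp; rfl
    have hc' : T c ∘ₗ T c⁻¹ = LinearMap.id := by
      rw [← Module.End.mul_eq_comp, ← map_mul]; simp; rfl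
    let e : (Fin d → ℂ) ≃ₗ[ℂ] (Fin d → ℂ) := LinearEquiv.ofLinearMap (T c) (T c⁻¹) hc' hc
    obtain ⟨φ, hφ, hq⟩ := pairing_charOf T (c * s * c⁻¹) (b.map e) l
      (by
        intro i
        have e1 : T c⁻¹ (T c (b i)) = b i := LinearMap.congr_fun hc (b i)
        change T (c * s * c⁻¹) (T c (b i)) = (l i : ℂ) • T c (b i)
        rw [map_mul, map_mul, Module.End.mul_apply, Module.End.mul_apply, e1, h, map_smul])
      (by
        intro i
        rw [← h1 i]
        congr 1
        exact (orderOf_eq_orderOf_iff.2 fun n => by simp [conj_pow]))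
    rw [hp, hq]
    exact Finset.sum_congr rfl fun i _ => pairingDegOne_unique _ _ _ _ ((hψ i).trans (hφ i).symm)
  | h0 => simp
  | ha x y hx hy => rw [map_add, map_add, hx, hy]
  | hz n x hx => rw [map_smul, map_smul, hx]

/-- The pairing `χ ↦ ⟨χ, c⟩` for a conjugacy class `c`. -/
def pairingConj (c : ConjClasses G) : VirtualChar G →ₗ[ℤ] ℚ :=
  Quotient.lift (s := IsConj.setoid G) pairing (fun _ _ h => pairing_eq_of_isConj h) c

theorem pairingConj_mk (s : G) : pairingConj (ConjClasses.mk s) = pairing s := rfl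

/-- The Stickelberger map `Θ : ℚR_G → ℚḠ`, `χ ↦ ∑_c ⟨χ, c⟩ c`, where `ℚR_G = ℚ ⊗ R_G` and `ℚḠ`
is the `ℚ`-vector space with basis the set `Ḡ` of conjugacy classes of `G`. -/
def theta : ℚ ⊗[ℤ] VirtualChar G →ₗ[ℚ] (ConjClasses G →₀ ℚ) :=
  (Finsupp.linearEquivFunOnFinite ℚ ℚ (ConjClasses G)).symm.toLinearMap ∘ₗ
    LinearMap.pi fun c => (pairingConj c).liftBaseChange ℚ

theorem theta_tmul_apply (q : ℚ) (χ : VirtualChar G) (c : ConjClasses G) :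
    theta (q ⊗ₜ[ℤ] χ) c = q * pairingConj c χ := by
  simp [theta]

/-! ### Determinants and the kernel `A_G` -/

theorem exists_det :
    ∃ D : VirtualChar G →+ Additive (G →* ℂˣ),
      ∀ (d : ℕ) (T : Representation ℂ G (Fin d → ℂ)) (s : G),
        (((D (charOf T)).toMul s : ℂˣ) : ℂ) = LinearMap.det (T s) := by
  have key : ∀ χ : VirtualChar G, ∃ φ : G →* ℂˣ, ∀ s,
      (φ s : ℂ) = Complex.exp (2 * Real.pi * Complex.I * (pairing s χ : ℂ)) := by
    intro χ
    induction χ using virtualChar_induction with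
    | hc d T =>
      refine ⟨(Units.map (LinearMap.det : Module.End ℂ (Fin d → ℂ) →* ℂ)).comp
        (MonoidHom.toHomUnits T), fun s => ?_⟩
      rw [exp_pairing_charOf]; rfl
    | h0 => exact ⟨1, fun s => by simp⟩
    | ha x y hx hy =>
      obtain ⟨φ, hφ⟩ := hx
      obtain ⟨φ', hφ'⟩ := hy
      refine ⟨φ * φ', fun s => ?_⟩
      rw [MonoidHom.mul_apply, Units.val_mul, hφ, hφ', ← Complex.exp_add, map_add]
      push_cast
      rw [mul_add]
    | hz n x hx =>
      obtain ⟨φ, hφ⟩ := hx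
      refine ⟨φ ^ n, fun s => ?_⟩
      have : (φ ^ n) s = φ s ^ n := rfl
      rw [this, Units.val_zpow_eq_zpow_val, hφ, ← Complex.exp_int_mul, map_smul]
      rw [zsmul_eq_mul]
      push_cast
      congr 1
      ring
  choose φ hφ using key
  refine ⟨AddMonoidHom.mk' (fun χ => Additive.ofMul (φ χ)) ?_, ?_⟩
  · intro x y
    apply Additive.toMul.injective
    ext s
    change (φ (x + y) s : ℂ) = ((φ x s * φ y s : ℂˣ) : ℂ)
    rw [Units.val_mul, hφ, hφ, hφ, ← Complex.exp_add, map_add]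
    push_cast
    rw [mul_add]
  · intro d T s
    change (φ (charOf T) s : ℂ) = _
    rw [hφ, exp_pairing_charOf]

/-- The homomorphism `det` from `R_G` to the group of characters of degree one of `G`: the unique
homomorphism which sends the character of `T` to `s ↦ det (T s)`. -/
def detHom : VirtualChar G →+ Additive (G →* ℂˣ) := (exists_det (G := G)).choose

theorem detHom_charOf (d : ℕ) (T : Representation ℂ G (Fin d → ℂ)) (s : G) :
    (((detHom (charOf T)).toMul s : ℂˣ) : ℂ) = LinearMap.det (T s) :=
  (exists_det (G := G)).choose_spec d T s

variable (G)

/-- The group `A_G`, the kernel of `det`. -/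
def AG : AddSubgroup (VirtualChar G) := (detHom (G := G)).ker

/-- The character `ρ_G` of the regular representation of `G`. -/
def regularChar : VirtualChar G :=
  haveI : FiniteDimensional ℂ (MonoidAlgebra ℂ G) :=
    Module.Finite.of_basis (MonoidAlgebra.basis G ℂ)
  charOf (Representation.leftRegular ℂ G)

end Characters

/-! ### The absolute Galois group and the cyclotomic action on conjugacy classes -/

section Arithmetic

open NumberField

variable (K : Type*) [Field K] [Algebra K ℂ]

/-- The algebraic closure `Kᶜ ⊆ ℂ` of `K`. -/
abbrev Kc : IntermediateField K ℂ := algebraicClosure K ℂ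

/-- The absolute Galois group `Ω = Gal(Kᶜ/K)`. -/
abbrev Omega : Type _ := Kc K ≃ₐ[K] Kc K

variable (G : Type*) [Group G] [Finite G]

theorem card_rootsOfUnity_Kc :
    Nat.card {x // x ∈ rootsOfUnity (Monoid.exponent G) (Kc K)} = Monoid.exponent G := by
  have : IsAlgClosed (Kc K) := (algebraicClosure.isAlgClosure (F := K) (E := ℂ)).isAlgClosed
  have : NeZero ((Monoid.exponent G : ℕ) : Kc K) :=
    ⟨Nat.cast_ne_zero.2 (NeZero.ne (Monoid.exponent G))⟩
  exact HasEnoughRootsOfUnity.natCard_rootsOfUnity (Kc K) (Monoid.exponent G)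

/-- The cyclotomic character `κ : Ω → (ℤ/eℤ)ˣ`, where `e` is the exponent of `G`:
`ω ζ = ζ ^ κ(ω)` for every `ζ` with `ζ ^ e = 1`. -/
def kappa : Omega K →* (ZMod (Monoid.exponent G))ˣ where
  toFun ω := modularCyclotomicCharacter (Kc K) (card_rootsOfUnity_Kc K G) ω.toRingEquiv
  map_one' := map_one (modularCyclotomicCharacter (Kc K) (card_rootsOfUnity_Kc K G))
  map_mul' ω τ := map_mul (modularCyclotomicCharacter (Kc K) (card_rootsOfUnity_Kc K G))
    ω.toRingEquiv τ.toRingEquiv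

theorem kappa_spec (ω : Omega K) (ζ : Kc K) (hζ : ζ ^ Monoid.exponent G = 1) :
    ω ζ = ζ ^ ((kappa K G ω : ZMod (Monoid.exponent G))).val := by
  obtain ⟨u, rfl⟩ := IsUnit.of_pow_eq_one hζ (NeZero.ne _)
  exact modularCyclotomicCharacter.spec (Kc K) (card_rootsOfUnity_Kc K G) ω.toRingEquiv
    (t := u) ((mem_rootsOfUnity _ _).2 (Units.ext hζ))

variable {G} in
/-- The map `s̄ ↦ (s ^ k)‾` on conjugacy classes. -/
def powConj (k : ℕ) : ConjClasses G → ConjClasses G :=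
  Quotient.map (sa := IsConj.setoid G) (sb := IsConj.setoid G) (fun s => s ^ k)
    (fun _ _ h => IsConj.pow k h)

/-- The set `Ḡ` of conjugacy classes of `G`, to be equipped with the action of `Ω = Gal(Kᶜ/K)`
through `κ⁻¹`. -/
@[nolint unusedArguments]
def CycConj (_K : Type*) (G : Type*) [Group G] : Type _ := ConjClasses G

variable {G} in
/-- The conjugacy class `s̄` of `s`. -/
def cls (s : G) : CycConj K G := ConjClasses.mk s

theorem pow_val_mul (s : G) (a b : ZMod (Monoid.exponent G)) :
    s ^ (a * b).val = (s ^ b.val) ^ a.val := by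
  rw [ZMod.val_mul, ← pow_mul, mul_comm b.val]
  exact (pow_eq_pow_iff_modEq.2 ((Nat.mod_modEq _ _).of_dvd (Monoid.order_dvd_exponent s)))

instance : MulAction (Omega K) (CycConj K G) where
  smul ω c := powConj (((kappa K G ω)⁻¹ : (ZMod (Monoid.exponent G))ˣ) :
    ZMod (Monoid.exponent G)).val c
  one_smul c := by
    induction c using Quotient.inductionOn with
    | h s =>
      change ConjClasses.mk (s ^ _) = ConjClasses.mk s
      rw [map_one, inv_one, Units.val_one]
      congr 1
      have h := ZMod.val_one_eq_one_mod (Monoid.exponent G)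
      rw [h]
      nth_rewrite 2 [← pow_one s]
      exact (pow_eq_pow_iff_modEq.2 ((Nat.mod_modEq _ _).of_dvd (Monoid.order_dvd_exponent s)))
  mul_smul ω τ c := by
    induction c using Quotient.inductionOn with
    | h s =>
      change ConjClasses.mk (s ^ _) = ConjClasses.mk ((s ^ _) ^ _)
      rw [map_mul, mul_inv, Units.val_mul, pow_val_mul]

theorem smul_cls (ω : Omega K) (s : G) :
    ω • cls K s = cls K (s ^ (((kappa K G ω)⁻¹ : (ZMod (Monoid.exponent G))ˣ) :
      ZMod (Monoid.exponent G)).val) := rfl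

/-- The field `K(s̄)`: the subfield of `Kᶜ` fixed by the `Ω`-stabilizer of the class `s̄`. -/
def fieldAt (c : CycConj K G) : IntermediateField K (Kc K) :=
  IntermediateField.fixedField (MulAction.stabilizer (Omega K) c)

/-- The inclusion `ℤḠ ⊆ ℚḠ`. -/
def intToRat : (CycConj K G →₀ ℤ) →+ (ConjClasses G →₀ ℚ) :=
  Finsupp.mapRange.addMonoidHom (Int.castAddHom ℚ)

theorem intToRat_apply (x : CycConj K G →₀ ℤ) (c : ConjClasses G) :
    intToRat K G x c = ((x : CycConj K G → ℤ) c : ℚ) := rfl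

/-! ### Adèles and idèles -/

variable [NumberField K]

/-- The adèle ring `𝔸(K) ⊗_K L` of an algebraic extension `L` of `K` (for `L = Kᶜ` this is the
adèle ring `𝔸(Kᶜ)`), as an algebra over the adèle ring `𝔸(K)` of `K`. -/
abbrev AdeleExt (L : Type*) [Field L] [Algebra K L] : Type _ := AdeleRing (𝓞 K) K ⊗[K] L

/-- The idèle group `𝕁(L) = (𝔸(K) ⊗_K L)ˣ`. -/
abbrev IdeleExt (L : Type*) [Field L] [Algebra K L] : Type _ := (AdeleExt K L)ˣ

/-- The map `𝔸(L) → 𝔸(M)` induced by a `K`-embedding `L → M`. -/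
def adeleMap {L M : Type*} [Field L] [Algebra K L] [Field M] [Algebra K M] (f : L →ₐ[K] M) :
    AdeleExt K L →ₐ[AdeleRing (𝓞 K) K] AdeleExt K M :=
  Algebra.TensorProduct.map (AlgHom.id (AdeleRing (𝓞 K) K) (AdeleRing (𝓞 K) K)) f

/-- The map `𝕁(L) → 𝕁(M)` induced by a `K`-embedding `L → M`. -/
def ideleMap {L M : Type*} [Field L] [Algebra K L] [Field M] [Algebra K M] (f : L →ₐ[K] M) :
    IdeleExt K L →* IdeleExt K M :=
  Units.map (adeleMap K f : AdeleExt K L →* AdeleExt K M)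

/-- The inclusion `𝕁(K) → 𝕁(L)`. -/
def ideleIncl (L : Type*) [Field L] [Algebra K L] : (AdeleRing (𝓞 K) K)ˣ →* IdeleExt K L :=
  Units.map (algebraMap (AdeleRing (𝓞 K) K) (AdeleExt K L) : AdeleRing (𝓞 K) K →* AdeleExt K L)

/-- The norm `N_{L/K} : 𝕁(L) → 𝕁(K)` for a finite extension `L` of `K`: the norm of the free
`𝔸(K)`-algebra `𝔸(K) ⊗_K L`. -/
def ideleNorm (L : Type*) [Field L] [Algebra K L] : IdeleExt K L →* (AdeleRing (𝓞 K) K)ˣ :=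
  Units.map (Algebra.norm (AdeleRing (𝓞 K) K))

/-- The idèle group `𝕁(KΛ̄) = Hom_Ω(ℤḠ, 𝕁(Kᶜ))`: the `Ω`-equivariant homomorphisms from the
free abelian group on `Ḡ` (with `Ω` acting on `Ḡ` through `κ⁻¹`) to `𝕁(Kᶜ)`. -/
def IdeleHom : Subgroup (Multiplicative (CycConj K G →₀ ℤ) →* IdeleExt K (Kc K)) where
  carrier := {h | ∀ (ω : Omega K) (x : CycConj K G →₀ ℤ),
    h (Multiplicative.ofAdd (x.mapDomain (fun c => ω • c))) =
      ideleMap K (ω : Kc K →ₐ[K] Kc K) (h (Multiplicative.ofAdd x))}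
  mul_mem' {a b} ha hb ω x := by simp [ha ω x, hb ω x]
  one_mem' ω x := by simp
  inv_mem' {a} ha ω x := by simp [ha ω x]

theorem adeleMap_injective {L M : Type*} [Field L] [Algebra K L] [Field M] [Algebra K M]
    (f : L →ₐ[K] M) : Function.Injective (adeleMap K f) :=
  Module.Flat.lTensor_preserves_injective_linearMap (M := AdeleRing (𝓞 K) K)
    f.toLinearMap f.injective

theorem exists_adele_descent (H : Subgroup (Omega K)) (x : AdeleExt K (Kc K))
    (hx : ∀ ω ∈ H, adeleMap K (ω : Kc K →ₐ[K] Kc K) x = x) :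
    ∃ y : AdeleExt K (IntermediateField.fixedField H),
      adeleMap K (IntermediateField.fixedField H).val y = x := by
  classical
  let b := Module.Basis.ofVectorSpace K (AdeleRing (𝓞 K) K)
  let E := TensorProduct.equivFinsuppOfBasisLeft (N := Kc K) b
  have hE : ∀ (ω : Omega K) (z : AdeleExt K (Kc K)) i,
      E (adeleMap K (ω : Kc K →ₐ[K] Kc K) z) i = ω (E z i) := by
    intro ω z i
    induction z using TensorProduct.induction_on with
    | zero => simp
    | tmul a c => simp [E, adeleMap]; exact (ω.toLinearMap.map_smul _ _).symm
    | add z w hz hw => simp [map_add, hz, hw]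
  have hmem : ∀ i, E x i ∈ IntermediateField.fixedField H := by
    intro i
    rw [IntermediateField.mem_fixedField_iff]
    intro ω hω
    rw [← hE, hx ω hω]
  refine ⟨∑ i ∈ (E x).support, b i ⊗ₜ[K] (⟨E x i, hmem i⟩ : IntermediateField.fixedField H), ?_⟩
  rw [map_sum]
  have h1 : x = E.symm (E x) := (E.symm_apply_apply x).symm
  conv_rhs => rw [h1]
  simp only [E, TensorProduct.equivFinsuppOfBasisLeft_symm_apply, Finsupp.sum]
  rfl

variable {K G}

/-- The value of `h` at a class `c`, an element of `𝕁(Kᶜ)`. -/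
def value (h : IdeleHom K G) (c : CycConj K G) : IdeleExt K (Kc K) :=
  h.1 (Multiplicative.ofAdd (Finsupp.single c 1))

theorem value_fixed (h : IdeleHom K G) (c : CycConj K G) (ω : Omega K)
    (hω : ω ∈ MulAction.stabilizer (Omega K) c) :
    ideleMap K (ω : Kc K →ₐ[K] Kc K) (value h c) = value h c := by
  have h1 := h.2 ω (Finsupp.single c 1)
  rw [Finsupp.mapDomain_single, MulAction.mem_stabilizer_iff.1 hω] at h1
  exact h1.symm

theorem exists_evalAt (h : IdeleHom K G) (c : CycConj K G) :
    ∃ y : IdeleExt K (fieldAt K G c), ideleMap K (fieldAt K G c).val y = value h c := by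
  obtain ⟨y, hy⟩ : ∃ y : AdeleExt K (fieldAt K G c),
      adeleMap K (fieldAt K G c).val y = (value h c).val := exists_adele_descent K (MulAction.stabilizer (Omega K) c)
    (value h c : AdeleExt K (Kc K))
    (fun ω hω => congrArg Units.val (value_fixed h c ω hω))
  obtain ⟨z, hz⟩ : ∃ z : AdeleExt K (fieldAt K G c),
      adeleMap K (fieldAt K G c).val z = ((value h c)⁻¹).val := exists_adele_descent K (MulAction.stabilizer (Omega K) c)
    ((value h c)⁻¹ : IdeleExt K (Kc K)).val
    (fun ω hω => by
      have := congrArg (fun u : IdeleExt K (Kc K) => (u⁻¹).val) (value_fixed h c ω hω)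
      simp only [← map_inv] at this
      exact this)
  have hyz : y * z = 1 := by
    apply adeleMap_injective K (fieldAt K G c).val
    rw [map_mul, hy, hz, map_one, Units.mul_inv]
  exact ⟨⟨y, z, hyz, by rw [mul_comm, hyz]⟩, Units.ext hy⟩

/-- The value `h(s̄)` as an element of the idèle group `𝕁(K(s̄)) ⊆ 𝕁(Kᶜ)`. -/
def evalAt (h : IdeleHom K G) (c : CycConj K G) : IdeleExt K (fieldAt K G c) :=
  (exists_evalAt h c).choose

theorem ideleMap_evalAt (h : IdeleHom K G) (c : CycConj K G) :
    ideleMap K (fieldAt K G c).val (evalAt h c) = value h c :=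
  (exists_evalAt h c).choose_spec

/-- The norm `N_{K(s̄)/K}(h(s̄)) ∈ 𝕁(K)`. -/
def normAt (h : IdeleHom K G) (s : G) : (AdeleRing (𝓞 K) K)ˣ :=
  ideleNorm K (fieldAt K G (cls K s)) (evalAt h (cls K s))

variable (K) in
/-- `S` is a set of elements of `G` whose conjugacy classes form a set of representatives of the
`Ω`-orbits of `Ḡ`. -/
def IsOrbitReps (S : Finset G) : Prop :=
  ∀ c : CycConj K G, ∃! s : G, s ∈ S ∧ c ∈ MulAction.orbit (Omega K) (cls K s)

end Arithmetic

end Stickelberger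

end

open Stickelberger

namespace Stickelberger

/-! ### The group $A_G$ and integrality of the pairings. -/

section Characters

variable {G : Type*} [Group G] [Finite G]

/-! The coefficient of $\Theta(\rho_G)$ at $\bar s$ depends only on $m = |s|$. On $\langle s\rangle$
the regular character restricts to $n/m$ copies of the sum of all characters of degree one, whose
pairings with $s$ are $0, 1/m, \dots, (m-1)/m$, so $\langle\rho_G, s\rangle =
\frac{n}{m}\frac{m-1}{2}$ (`pairing_regularChar`). Since $\det\chi(s) = e^{2\pi
i\langle\chi,s\rangle}$, membership in $A_G$ means that all pairings are integers (`mem_AG_iff`).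
This gives $2\rho_G \in A_G$ at once, and integrality when $\rho_G \in A_G$.

On the idelic side, $N_{K(\bar s)/K}$ becomes in $\mathbb J(K^c)$ the product over the
$K$-embeddings $K(\bar s) \to K^c$. These correspond to the points of the $\Omega$-orbit of $\bar
s$, so by equivariance the norm of $h(\bar s)$ is the product of $h$ over that orbit
(`ideleIncl_normAt`). The action raises elements to powers prime to their order, so $|s|$ is
constant on orbits. Grouping the factors of $h(\Theta)$ by orbit and then by order gives both
formulas (`apply_eq_ideleIncl_prod`). -/

theorem detHom_eq_exp_pairing (χ : VirtualChar G) (s : G) :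
    (((detHom χ).toMul s : ℂˣ) : ℂ) =
      Complex.exp (2 * Real.pi * Complex.I * (pairing s χ : ℂ)) := by
  induction χ using virtualChar_induction with
  | hc d T => rw [detHom_charOf, exp_pairing_charOf]
  | h0 => simp
  | ha x y hx hy =>
    rw [map_add, toMul_add, MonoidHom.mul_apply, Units.val_mul, hx, hy, ← Complex.exp_add, map_add]
    push_cast
    rw [mul_add]
  | hz n x hx =>
    have : ((n • detHom x).toMul : G →* ℂˣ) s = (detHom x).toMul s ^ n := rfl
    rw [map_zsmul, this, Units.val_zpow_eq_zpow_val, hx, ← Complex.exp_int_mul, map_smul,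
      zsmul_eq_mul]
    push_cast
    congr 1
    ring

/-- A virtual character lies in `A_G` if and only if all its pairings are integers. -/
theorem mem_AG_iff (χ : VirtualChar G) : χ ∈ AG G ↔ ∀ s, ∃ a : ℤ, pairing s χ = a := by
  have h1 : χ ∈ AG G ↔ ∀ s, (((detHom χ).toMul s : ℂˣ) : ℂ) = 1 := by
    rw [AG, AddMonoidHom.mem_ker, ← Additive.toMul.injective.eq_iff, MonoidHom.ext_iff]
    exact forall_congr' fun s => Units.ext_iff
  rw [h1]
  refine forall_congr' fun s => ?_
  rw [detHom_eq_exp_pairing, Complex.exp_eq_one_iff]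
  refine exists_congr fun a => ?_
  rw [mul_comm, mul_left_inj' Complex.two_pi_I_ne_zero]
  exact ⟨fun h => by exact_mod_cast h, fun h => by rw [h]; simp⟩

/-- Two rationals with the same exponential differ by an integer, which vanishes when both lie in
$[0,1)$. This makes the chosen value `pairingDegOne` computable. -/
theorem pairingDegOne_eq {C : Type*} [Group C] [Finite C] (ψ : C →* ℂˣ) (s : C) (q : ℚ)
    (h0 : 0 ≤ q) (h1 : q < 1)
    (h : (ψ s : ℂ) = Complex.exp (2 * Real.pi * Complex.I * (q : ℂ))) :
    pairingDegOne ψ s = q := by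
  obtain ⟨a0, a1, ha⟩ := pairingDegOne_spec ψ s
  rw [h, Complex.exp_eq_exp_iff_exists_int] at ha
  obtain ⟨n, hn⟩ := ha
  have h2 : (q : ℂ) = (pairingDegOne ψ s : ℂ) + n := by
    apply mul_left_cancel₀ Complex.two_pi_I_ne_zero
    rw [hn]; ring
  have h3 : q = pairingDegOne ψ s + n := by exact_mod_cast h2
  have h4 : n = 0 := by
    have e1 : (n : ℚ) < 1 := by linarith
    have e2 : (-1 : ℚ) < n := by linarith
    have e3 : n < 1 := by exact_mod_cast e1
    have e4 : -1 < n := by exact_mod_cast e2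
    omega
  rw [h3, h4]; simp

/-! ### The regular character: its pairings and their parity. -/

theorem regularChar_apply (g : G) [Decidable (g = 1)] :
    (regularChar G : G → ℂ) g = if g = 1 then (Nat.card G : ℂ) else 0 := by
  classical
  have := Fintype.ofFinite G
  change LinearMap.trace ℂ _ (Representation.leftRegular ℂ G g) = _
  rw [LinearMap.trace_eq_matrix_trace ℂ (MonoidAlgebra.basis G ℂ), Matrix.trace]
  have : ∀ x : G, (LinearMap.toMatrix (MonoidAlgebra.basis G ℂ) (MonoidAlgebra.basis G ℂ)
      (Representation.leftRegular ℂ G g)).diag x = if g = 1 then (1 : ℂ) else 0 := by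
    intro x
    rw [Matrix.diag_apply, LinearMap.toMatrix_apply]
    have e : (MonoidAlgebra.basis G ℂ) x = MonoidAlgebra.single x 1 := by simp
    rw [e, Representation.ofMulAction_single, smul_eq_mul]
    have e' : MonoidAlgebra.single (g * x) (1 : ℂ) = MonoidAlgebra.basis G ℂ (g * x) := by simp
    rw [e', Module.Basis.repr_self, Finsupp.single_apply]
    simp
  rw [Finset.sum_congr rfl fun x _ => this x]
  simp

/-- The restriction of the regular character to a cyclic subgroup is a multiple of the sum of all
characters of degree one. -/
theorem pairing_regularChar (s : G) :
    pairing s (regularChar G) = ((Nat.card G / orderOf s * (orderOf s - 1) : ℕ) : ℚ) / 2 := by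
  classical
  set m := orderOf s with hm
  have hm0 : 0 < m := orderOf_pos s
  set t : Subgroup.zpowers s := ⟨s, Subgroup.mem_zpowers s⟩ with ht
  have hg : ∀ x, x ∈ Subgroup.zpowers t := by
    rintro ⟨x, k, rfl⟩
    exact ⟨k, Subtype.ext (by simp [t])⟩
  have ho : orderOf t = m := by simp [t, hm]
  have hζ := Complex.isPrimitiveRoot_exp m hm0.ne'
  set ζ := Complex.exp (2 * Real.pi * Complex.I / m) with hζd
  obtain ⟨z, hz⟩ := hζ.isUnit hm0.ne'
  have hzm : z ^ m = 1 := Units.ext (by simpa [hz] using hζ.pow_eq_one)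
  have hz' : ∀ i : ℕ, orderOf (z ^ i) ∣ orderOf t := fun i =>
    orderOf_dvd_of_pow_eq_one (by rw [ho, ← pow_mul, mul_comm, pow_mul, hzm, one_pow])
  -- For $i < m$ these are all the characters of degree one of $\langle s\rangle$, sending the
  -- generator to $\zeta^i$.
  let ψ : ℕ → (Subgroup.zpowers s →* ℂˣ) := fun i => monoidHomOfForallMemZpowers hg (hz' i)
  have hψ : ∀ i, ψ i t = z ^ i := fun i => monoidHomOfForallMemZpowers_apply_gen _ _
  have hres : res (Subgroup.zpowers s) (regularChar G) =
      ((Nat.card G / m : ℕ) : ℤ) • ∑ i ∈ Finset.range m, linChar (ψ i) := by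
    apply Subtype.ext
    funext x
    obtain ⟨k, rfl⟩ := mem_powers_iff_mem_zpowers.2 (hg x)
    have e1 : (((((Nat.card G / m : ℕ) : ℤ) • ∑ i ∈ Finset.range m, linChar (ψ i) :
        VirtualChar (Subgroup.zpowers s)) : Subgroup.zpowers s → ℂ)) (t ^ k) =
        ((Nat.card G / m : ℕ) : ℂ) * ∑ i ∈ Finset.range m, (ζ ^ k) ^ i := by
      simp only [Submodule.coe_smul, Submodule.coe_sum, Pi.smul_apply, Finset.sum_apply,
        linChar_apply, map_pow, hψ, zsmul_eq_mul, Int.cast_natCast, Units.val_pow_eq_pow_val, hz]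
      simp only [← pow_mul, mul_comm]
    change (res (Subgroup.zpowers s) (regularChar G) : Subgroup.zpowers s → ℂ) (t ^ k) =
      (((((Nat.card G / m : ℕ) : ℤ) • ∑ i ∈ Finset.range m, linChar (ψ i) :
        VirtualChar (Subgroup.zpowers s)) : Subgroup.zpowers s → ℂ)) (t ^ k)
    rw [e1, res_apply, regularChar_apply]
    have e2 : ((t ^ k : Subgroup.zpowers s) : G) = s ^ k := rfl
    rw [e2]
    -- The geometric sum of the powers of $\zeta^k$ is $m$ if $s^k = 1$ and $0$ otherwise, matching
    -- the regular character.
    split_ifs with h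
    · have h' : ζ ^ k = 1 := hζ.pow_eq_one_iff_dvd k |>.2 (orderOf_dvd_of_pow_eq_one h)
      rw [h']
      simp only [one_pow, Finset.sum_const, Finset.card_range, nsmul_eq_mul, mul_one]
      rw [← Nat.cast_mul, Nat.div_mul_cancel (orderOf_dvd_natCard s)]
    · have h' : ζ ^ k ≠ 1 := fun h' =>
        h (orderOf_dvd_iff_pow_eq_one.1 ((hζ.pow_eq_one_iff_dvd k).1 h'))
      rw [geom_sum_eq h', ← pow_mul, mul_comm k, pow_mul, hζ.pow_eq_one, one_pow, sub_self,
        zero_div, mul_zero]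
  have hp : ∀ i ∈ Finset.range m, pairingDegOne (ψ i) t = (i : ℚ) / m := by
    intro i hi
    have hmq : (0 : ℚ) < m := by exact_mod_cast hm0
    refine pairingDegOne_eq _ _ _ (by positivity) ?_ ?_
    · rw [div_lt_one hmq]; exact_mod_cast Finset.mem_range.1 hi
    · rw [hψ, Units.val_pow_eq_pow_val, hz, hζd, ← Complex.exp_nat_mul]
      push_cast
      congr 1
      ring
  rw [pairing, LinearMap.comp_apply, hres, map_smul, map_sum]
  have h1 : ∀ i ∈ Finset.range m, ((degOneBasis (Subgroup.zpowers s)).constr ℤ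
      fun ψ => pairingDegOne ψ t) (linChar (ψ i)) = (i : ℚ) / m := by
    intro i hi
    rw [← degOneBasis_apply, Module.Basis.constr_basis, hp i hi]
  rw [Finset.sum_congr rfl h1, ← Finset.sum_div, ← Nat.cast_sum]
  have h2 : ((∑ i ∈ Finset.range m, i : ℕ) : ℚ) * 2 = m * ((m - 1 : ℕ) : ℚ) := by
    exact_mod_cast Finset.sum_range_id_mul_two m
  have hmq : (m : ℚ) ≠ 0 := by exact_mod_cast hm0.ne'
  rw [eq_div_iff two_ne_zero, zsmul_eq_mul, mul_assoc, div_mul_eq_mul_div, h2,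
    mul_div_cancel_left₀ _ hmq]
  push_cast
  rfl

theorem pairing_two_nsmul_regularChar (s : G) :
    pairing s (2 • regularChar G) = ((Nat.card G / orderOf s * (orderOf s - 1) : ℕ) : ℚ) := by
  rw [map_nsmul, pairing_regularChar, nsmul_eq_mul]
  push_cast
  ring

theorem two_nsmul_regularChar_mem_AG : 2 • regularChar G ∈ AG G :=
  (mem_AG_iff _).2 fun s => ⟨_, by rw [pairing_two_nsmul_regularChar]; exact (Int.cast_natCast _).symm⟩

theorem two_dvd_of_regularChar_mem_AG (h : regularChar G ∈ AG G) (s : G) :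
    2 ∣ Nat.card G / orderOf s * (orderOf s - 1) := by
  obtain ⟨a, ha⟩ := (mem_AG_iff _).1 h s
  rw [pairing_regularChar, div_eq_iff two_ne_zero] at ha
  generalize Nat.card G / orderOf s * (orderOf s - 1) = N at ha ⊢
  have : (N : ℤ) = a * 2 := by exact_mod_cast ha
  omega

/-- A divisor $m$ of the exponent need not be the order of an element, so integrality of the
pairings does not apply to it directly. Parity involves only the 2-part of $m$, and the full 2-part
of the exponent is the order of some element. -/
theorem two_dvd_of_dvd_exponent (h : regularChar G ∈ AG G) {m : ℕ} (hm : m ∣ Monoid.exponent G) :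
    2 ∣ Nat.card G / m * (m - 1) := by
  have hm0 : 0 < m := Nat.pos_of_dvd_of_pos hm (NeZero.pos _)
  rcases Nat.even_or_odd m with hev | hodd
  swap
  · exact Dvd.dvd.mul_left (Nat.Odd.sub_odd hodd odd_one).two_dvd _
  obtain ⟨s, hs⟩ := Nat.prime_two.exists_orderOf_eq_pow_factorization_exponent G
  set v := (Monoid.exponent G).factorization 2
  have he0 : Monoid.exponent G ≠ 0 := NeZero.ne _
  have hv : 0 < v := Nat.prime_two.factorization_pos_of_dvd he0 (hev.two_dvd.trans hm)
  have h1 := two_dvd_of_regularChar_mem_AG h s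
  rw [hs, Nat.prime_two.dvd_mul] at h1
  -- As $v > 0$, the factor $2^v - 1$ is odd.
  have h2 : 2 ∣ Nat.card G / 2 ^ v := by
    refine h1.resolve_right fun h3 => ?_
    have h4 : 2 ∣ 2 ^ v := dvd_pow_self 2 hv.ne'
    have h5 : 0 < 2 ^ v := by positivity
    omega
  have h3 : 2 ^ (v + 1) ∣ Nat.card G := by
    rw [pow_succ, ← Nat.mul_div_cancel' (hs ▸ orderOf_dvd_natCard s : 2 ^ v ∣ Nat.card G)]
    exact mul_dvd_mul_left _ h2
  refine Dvd.dvd.mul_right ?_ _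
  -- If $n/m$ were odd, all of $2^{v+1}$ would divide $m$, hence the exponent, against the choice of
  -- $v$.
  by_contra h4
  rw [← Nat.mul_div_cancel' (hm.trans Group.exponent_dvd_nat_card)] at h3
  have h5 := ((Nat.prime_two.coprime_iff_not_dvd.2 h4).pow_left (v + 1)).dvd_of_dvd_mul_right h3
  exact Nat.pow_succ_factorization_not_dvd he0 Nat.prime_two (h5.trans hm)

end Characters

/-! ### The norm after base change to an algebraically closed field. -/

section Norm

/-- The norm of `A ⊗ L` over `A`, for a finite separable extension `L` of `K`, is the product of the
maps induced by the embeddings of `L` into an algebraically closed field. -/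
theorem norm_tensorProduct_eq_prod_embeddings {K A L E : Type*} [Field K] [CommRing A] [Algebra K A]
    [Field L] [Algebra K L] [FiniteDimensional K L] [Algebra.IsSeparable K L] [Field E]
    [Algebra K E] [IsAlgClosed E] (u : A ⊗[K] L) :
    algebraMap A (A ⊗[K] E) (Algebra.norm A u) =
      ∏ σ : L →ₐ[K] E, Algebra.TensorProduct.map (AlgHom.id A A) σ u := by
  classical
  let b := Module.finBasis K L
  let B := Algebra.TensorProduct.basis A b
  have hcard : Fintype.card (Fin (Module.finrank K L)) = Fintype.card (L →ₐ[K] E) := by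
    rw [Fintype.card_fin, AlgHom.card]
  let e := Fintype.equivOfCardEq hcard
  let F : (L →ₐ[K] E) → (A ⊗[K] L →ₐ[A] A ⊗[K] E) :=
    fun σ => Algebra.TensorProduct.map (AlgHom.id A A) σ
  let ι : E →+* A ⊗[K] E := (Algebra.TensorProduct.includeRight : E →ₐ[K] A ⊗[K] E)
  let P0 := Algebra.embeddingsMatrixReindex K E b e
  -- The square of this determinant is the discriminant of the basis, nonzero by separability.
  -- Invertibility over the field $E$ passes to the ring $A \otimes E$, which may have zero
  -- divisors.
  have hP0 : P0.det ≠ 0 := by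
    intro h
    have h1 := Algebra.discr_eq_det_embeddingsMatrixReindex_pow_two K E b e
    rw [show (Algebra.embeddingsMatrixReindex K E b e).det = 0 from h] at h1
    have h2 := Algebra.discr_not_zero_of_basis K b
    exact h2 ((algebraMap K E).injective (by rw [h1]; simp))
  let P : Matrix _ _ (A ⊗[K] E) := P0.map ι
  have hP : IsUnit P.det := by
    have : P.det = ι P0.det := (RingHom.map_det ι P0).symm
    rw [this]
    exact (IsUnit.mk0 _ hP0).map ι
  let M := Algebra.leftMulMatrix B u
  have hF : ∀ i j, P i j = F (e j) (B i) := by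
    intro i j
    simp [P, P0, F, B, ι, Algebra.embeddingsMatrixReindex, Algebra.TensorProduct.basis_apply]
  -- The columns of `P` are eigenvectors of the transposed multiplication matrix of `u`: the map `F
  -- (e j)` is multiplicative, so it sends `u * B i` to the product of the images. Hence `P`
  -- diagonalises that matrix, with eigenvalues `F (e j) u`.
  have key : (M.map (algebraMap A (A ⊗[K] E))).transpose * P =
      P * Matrix.diagonal (fun j => F (e j) u) := by
    ext i j
    rw [Matrix.mul_diagonal, Matrix.mul_apply, hF, ← map_mul, mul_comm, ← B.sum_repr (u * B i),
      map_sum]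
    refine Finset.sum_congr rfl fun k _ => ?_
    rw [map_smul, ← hF, Algebra.smul_def, Matrix.transpose_apply, Matrix.map_apply,
      ← Algebra.leftMulMatrix_eq_repr_mul]
  have hdet := congrArg Matrix.det key
  rw [Matrix.det_mul, Matrix.det_mul, Matrix.det_transpose, mul_comm, hP.mul_right_inj,
    Matrix.det_diagonal] at hdet
  rw [Algebra.norm_eq_matrix_det B, RingHom.map_det]
  refine hdet.trans ?_
  exact Fintype.prod_equiv e _ _ fun _ => rfl

end Norm

/-! ### Norms of values of $h$ as products over $\Omega$-orbits. -/

section Arithmetic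

open NumberField

variable {K : Type*} [Field K] [NumberField K] [Algebra K ℂ] {G : Type*} [Group G] [Finite G]

instance isAlgClosed_Kc : IsAlgClosed (Kc K) :=
  (algebraicClosure.isAlgClosure (F := K) (E := ℂ)).isAlgClosed

theorem ideleIncl_ideleNorm (L : Type*) [Field L] [Algebra K L] [FiniteDimensional K L]
    (u : IdeleExt K L) :
    ideleIncl K (Kc K) (ideleNorm K L u) = ∏ σ : L →ₐ[K] Kc K, ideleMap K σ u := by
  apply Units.ext
  rw [Units.coe_prod]
  exact norm_tensorProduct_eq_prod_embeddings (E := Kc K) u.val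

omit [NumberField K] in
theorem smul_eq_self_of_kappa_eq_one {ω : Omega K} (h : kappa K G ω = 1) (c : CycConj K G) :
    ω • c = c := by
  -- The exponent for $\kappa = 1$ is the residue `.val` of $1$, which is $0$ when $e = 1$.
  -- Comparison with the identity automorphism avoids the case distinction.
  have h1 := one_smul (Omega K) c
  induction c using Quotient.inductionOn with
  | h s =>
    change ω • cls K s = cls K s
    change (1 : Omega K) • cls K s = cls K s at h1
    rw [smul_cls, map_one] at h1
    rw [smul_cls, h, h1]

variable (K G) in
/-- The kernel of the cyclotomic character contains the fixing subgroup of a finite extension. -/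
theorem exists_finiteDimensional_kappa_eq_one :
    ∃ F : IntermediateField K (Kc K), FiniteDimensional K F ∧
      ∀ ω ∈ F.fixingSubgroup, kappa K G ω = 1 := by
  have : NeZero ((Monoid.exponent G : ℕ) : Kc K) :=
    ⟨Nat.cast_ne_zero.2 (NeZero.ne (Monoid.exponent G))⟩
  obtain ⟨ζ, hζ⟩ := HasEnoughRootsOfUnity.exists_primitiveRoot (Kc K) (Monoid.exponent G)
  refine ⟨IntermediateField.adjoin K {ζ},
    IntermediateField.adjoin.finiteDimensional (Algebra.IsIntegral.isIntegral ζ), fun ω hω => ?_⟩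
  have h1 : ω ζ = ζ :=
    (IntermediateField.mem_fixingSubgroup_iff _ _).1 hω ζ (IntermediateField.mem_adjoin_simple_self K ζ)
  rw [kappa_spec K G ω ζ hζ.pow_eq_one] at h1
  obtain ⟨z, hz⟩ := hζ.isUnit (NeZero.ne _)
  have h2 : z ^ ((kappa K G ω : ZMod (Monoid.exponent G))).val = z ^ 1 :=
    Units.ext (by rw [Units.val_pow_eq_pow_val, hz, pow_one, hz]; exact h1)
  -- Since $\zeta$ has order exactly $e$, fixing it forces $\kappa(\omega) = 1$ modulo $e$.
  have h3 := pow_eq_pow_iff_modEq.1 h2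
  rw [← orderOf_units, hz, ← hζ.eq_orderOf, ← ZMod.natCast_eq_natCast_iff, ZMod.natCast_zmod_val, Nat.cast_one] at h3
  exact Units.ext h3

/-- The action factors through $\kappa$, so the stabilizer contains the fixing subgroup of a finite
extension, which is open. -/
theorem isOpen_stabilizer (c : CycConj K G) :
    IsOpen (MulAction.stabilizer (Omega K) c : Set (Omega K)) := by
  obtain ⟨F, hF, h⟩ := exists_finiteDimensional_kappa_eq_one K G
  exact Subgroup.isOpen_mono (fun ω hω => smul_eq_self_of_kappa_eq_one (h ω hω) c)
    F.fixingSubgroup_isOpen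

/-- The infinite Galois correspondence recovers only closed subgroups; the stabilizer is open, hence
closed. -/
theorem fixingSubgroup_fieldAt (c : CycConj K G) :
    (fieldAt K G c).fixingSubgroup = MulAction.stabilizer (Omega K) c :=
  InfiniteGalois.fixingSubgroup_fixedField
    ⟨MulAction.stabilizer (Omega K) c, Subgroup.isClosed_of_isOpen _ (isOpen_stabilizer c)⟩

instance finiteDimensional_fieldAt (c : CycConj K G) : FiniteDimensional K (fieldAt K G c) := by
  rw [← InfiniteGalois.isOpen_iff_finite, fixingSubgroup_fieldAt]
  exact isOpen_stabilizer c

omit [NumberField K] in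
-- The embedding extends because $K^c$ is algebraic over `L` and algebraically closed; an
-- endomorphism of the algebraic extension $K^c/K$ is automatically bijective.
theorem exists_lift_embedding (L : IntermediateField K (Kc K)) (σ : L →ₐ[K] Kc K) :
    ∃ ω : Omega K, (ω : Kc K →ₐ[K] Kc K).comp L.val = σ := by
  obtain ⟨φ, hφ⟩ := IsAlgClosed.surjective_domRestrict_of_isAlgebraic (E := Kc K) σ
  refine ⟨AlgEquiv.ofBijective φ (Algebra.IsAlgebraic.algHom_bijective φ), ?_⟩
  rw [← hφ]
  rfl

omit [Algebra K ℂ] in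
theorem ideleMap_comp {L M N : Type*} [Field L] [Algebra K L] [Field M] [Algebra K M] [Field N]
    [Algebra K N] (g : M →ₐ[K] N) (f : L →ₐ[K] M) (u : IdeleExt K L) :
    ideleMap K (g.comp f) u = ideleMap K g (ideleMap K f u) := by
  apply Units.ext
  change adeleMap K (g.comp f) u.val = adeleMap K g (adeleMap K f u.val)
  generalize u.val = x
  induction x using TensorProduct.induction_on with
  | zero => simp
  | tmul a c => simp [adeleMap]
  | add z w hz hw => simp [map_add, hz, hw]

theorem ideleMap_value (h : IdeleHom K G) (c : CycConj K G) (ω : Omega K) :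
    ideleMap K (ω : Kc K →ₐ[K] Kc K) (value h c) = value h (ω • c) := by
  have h1 := h.2 ω (Finsupp.single c 1)
  rw [Finsupp.mapDomain_single] at h1
  exact h1.symm

/-- The norm of `h(s̄)` is the product of the values of `h` over the orbit of `s̄`. -/
theorem ideleIncl_normAt (h : IdeleHom K G) (s : G) [Fintype (CycConj K G)]
    [DecidablePred (· ∈ MulAction.orbit (Omega K) (cls K s))] :
    ideleIncl K (Kc K) (normAt h s) =
      ∏ c with c ∈ MulAction.orbit (Omega K) (cls K s), value h c := by
  set L := fieldAt K G (cls K s)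
  choose lift hlift using exists_lift_embedding L
  rw [normAt, ideleIncl_ideleNorm]
  have hval : ∀ ω : Omega K, ideleMap K ((ω : Kc K →ₐ[K] Kc K).comp L.val) (evalAt h (cls K s)) =
      value h (ω • cls K s) := fun ω => by
    rw [ideleMap_comp, ideleMap_evalAt, ideleMap_value]
  -- Two automorphisms move $\bar s$ to the same class iff $\tau^{-1}\omega$ stabilizes it, that is,
  -- fixes $K(\bar s)$ pointwise. So embeddings of $K(\bar s)$ biject with points of the orbit.
  have hiff : ∀ ω τ : Omega K, ω • cls K s = τ • cls K s ↔
      (ω : Kc K →ₐ[K] Kc K).comp L.val = (τ : Kc K →ₐ[K] Kc K).comp L.val := by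
    intro ω τ
    rw [← inv_smul_eq_iff, smul_smul, ← MulAction.mem_stabilizer_iff, ← fixingSubgroup_fieldAt,
      IntermediateField.mem_fixingSubgroup_iff, AlgHom.ext_iff]
    have hx : ∀ x : Kc K, (τ⁻¹ * ω) x = x ↔ ω x = τ x := fun x => τ.symm_apply_eq
    exact ⟨fun H x => (hx x).1 (H x x.2), fun H x hxL => (hx x).2 (H ⟨x, hxL⟩)⟩
  refine Finset.prod_bij (fun σ _ => lift σ • cls K s) ?_ ?_ ?_ ?_
  · intro σ _
    exact Finset.mem_filter.2 ⟨Finset.mem_univ _, lift σ, rfl⟩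
  · intro σ _ τ _ hst
    rw [hiff, hlift, hlift] at hst
    exact hst
  · intro c hc
    obtain ⟨ω, rfl⟩ := (Finset.mem_filter.1 hc).2
    exact ⟨(ω : Kc K →ₐ[K] Kc K).comp L.val, Finset.mem_univ _, (hiff _ _).2 (hlift _)⟩
  · intro σ _
    rw [← hval, hlift]

omit [NumberField K] in
-- Conjugation preserves the order, and so does a power whose exponent is a unit modulo $e$, because
-- the order divides $e$.
theorem orderOf_eq_of_mem_orbit {s t : G} (h : cls K t ∈ MulAction.orbit (Omega K) (cls K s)) :
    orderOf t = orderOf s := by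
  obtain ⟨ω, hω⟩ := h
  change ω • cls K s = cls K t at hω
  rw [smul_cls] at hω
  obtain ⟨c, hc⟩ := isConj_iff.1 (ConjClasses.mk_eq_mk_iff_isConj.1 hω)
  rw [← hc]
  have h1 : ∀ x : G, orderOf (c * x * c⁻¹) = orderOf x := fun x =>
    orderOf_eq_orderOf_iff.2 fun n => by simp [conj_pow]
  rw [h1]
  exact (Nat.Coprime.coprime_dvd_right (Monoid.order_dvd_exponent s)
    (ZMod.val_coe_unit_coprime _)).symm.orderOf_pow

/-! ### Evaluation of $h$ on $\mathbb Z\bar G$, by orbit and by order. -/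

theorem apply_eq_prod_value (h : IdeleHom K G) [Fintype (CycConj K G)] (θ : CycConj K G →₀ ℤ) :
    h.1 (Multiplicative.ofAdd θ) = ∏ c, value h c ^ θ c := by
  conv_lhs => rw [← Finsupp.sum_single θ, Finsupp.sum_fintype _ _ (fun _ => Finsupp.single_zero _),
    ofAdd_sum, map_prod]
  refine Finset.prod_congr rfl fun c _ => ?_
  rw [value, ← map_zpow, ← ofAdd_zsmul, Finsupp.smul_single, smul_eq_mul, mul_one]

/-- The value of `h` at an element of `ℤḠ` whose coefficients depend only on the order. -/
theorem apply_eq_ideleIncl_prod (S : Finset G) (hS : IsOrbitReps K S) (h : IdeleHom K G)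
    (θ : CycConj K G →₀ ℤ) (f : ℕ → ℕ) (hθ : ∀ s : G, θ (cls K s) = f (orderOf s)) :
    h.1 (Multiplicative.ofAdd θ) =
      ideleIncl K (Kc K) (∏ m ∈ (Monoid.exponent G).divisors,
        (∏ s ∈ S with orderOf s = m, normAt h s) ^ f m) := by
  classical
  have : Finite (CycConj K G) := inferInstanceAs (Finite (ConjClasses G))
  have := Fintype.ofFinite (CycConj K G)
  -- `r` sends a class to the representative in `S` of its orbit, so the fibres of `r` over `S` are
  -- the orbits.
  choose r hr hr' using hS
  have hmk : ∀ c : CycConj K G, ∃ t : G, cls K t = c := fun c => Quotient.exists_rep c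
  have h1 : ∀ s ∈ S, ∀ c, r c = s ↔ c ∈ MulAction.orbit (Omega K) (cls K s) := fun s hs c =>
    ⟨fun e => e ▸ (hr c).2, fun hc => (hr' c s ⟨hs, hc⟩).symm⟩
  rw [apply_eq_prod_value, ← Finset.prod_fiberwise_of_maps_to (g := r) (t := S)
    (fun c _ => (hr c).1)]
  have h2 : ∀ s ∈ S, ∏ c with r c = s, value h c ^ θ c =
      ideleIncl K (Kc K) (normAt h s) ^ f (orderOf s) := by
    intro s hs
    rw [ideleIncl_normAt, ← Finset.prod_pow]
    refine Finset.prod_congr (Finset.filter_congr fun c _ => h1 s hs c) fun c hc => ?_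
    obtain ⟨t, rfl⟩ := hmk c
    rw [hθ, orderOf_eq_of_mem_orbit (Finset.mem_filter.1 hc).2, zpow_natCast]
  -- A divisor $m$ of $e$ that is not the order of any element of `S` contributes an empty product.
  rw [Finset.prod_congr rfl h2, ← Finset.prod_fiberwise_of_maps_to (g := orderOf)
    (t := (Monoid.exponent G).divisors)
    (fun s _ => Nat.mem_divisors.2 ⟨Monoid.order_dvd_exponent s, NeZero.ne _⟩), map_prod]
  refine Finset.prod_congr rfl fun m _ => ?_
  rw [map_pow, map_prod, ← Finset.prod_pow]
  refine Finset.prod_congr rfl fun s hs => ?_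
  rw [(Finset.mem_filter.1 hs).2]

omit [NumberField K] in
/-- If the pairings of `χ` are natural numbers depending only on the order, then `Θ(χ)` lies in
`ℤḠ`. -/
theorem exists_intToRat_eq_theta (χ : VirtualChar G) (f : ℕ → ℕ)
    (hf : ∀ s : G, pairing s χ = f (orderOf s)) :
    ∃ θ : CycConj K G →₀ ℤ, intToRat K G θ = theta ((1 : ℚ) ⊗ₜ[ℤ] χ) ∧
      ∀ s : G, θ (cls K s) = f (orderOf s) := by
  classical
  have : Finite (CycConj K G) := inferInstanceAs (Finite (ConjClasses G))
  have hint : ∀ c : CycConj K G, ∃ a : ℤ, pairingConj c χ = a := fun c => by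
    obtain ⟨s, rfl⟩ := Quotient.exists_rep c
    exact ⟨f (orderOf s), by rw [Int.cast_natCast, ← hf s]; rfl⟩
  choose a ha using hint
  refine ⟨Finsupp.equivFunOnFinite.symm a, ?_, fun s => ?_⟩
  · ext c
    rw [intToRat_apply, theta_tmul_apply, one_mul]
    exact (ha c).symm
  · have h1 : pairing s χ = a (cls K s) := ha (cls K s)
    rw [hf] at h1
    exact_mod_cast h1.symm

end Arithmetic
end Stickelberger

/-! ### The two formulas. -/

theorem proposition15 {K : Type*} [Field K] [NumberField K] [Algebra K ℂ]
    {G : Type*} [Group G] [Finite G]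
    (S : Finset G) (hS : IsOrbitReps K S) (h : IdeleHom K G) :
    (regularChar G ∈ AG G →
      (∀ m ∈ (Monoid.exponent G).divisors, 2 ∣ Nat.card G / m * (m - 1)) ∧
      ∃ θ : CycConj K G →₀ ℤ,
        intToRat K G θ =
          theta ((1 : ℚ) ⊗ₜ[ℤ] regularChar G) ∧
        h.1 (Multiplicative.ofAdd θ) =
          ideleIncl K (Kc K)
            (∏ m ∈ (Monoid.exponent G).divisors,
              (∏ s ∈ S with orderOf s = m, normAt h s) ^
                (Nat.card G / m * (m - 1) / 2))) ∧
    (2 • regularChar G ∈ AG G ∧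
      ∃ θ : CycConj K G →₀ ℤ,
        intToRat K G θ =
          theta ((1 : ℚ) ⊗ₜ[ℤ] (2 • regularChar G)) ∧
        h.1 (Multiplicative.ofAdd θ) =
          ideleIncl K (Kc K)
            (∏ m ∈ (Monoid.exponent G).divisors,
              (∏ s ∈ S with orderOf s = m, normAt h s) ^
                (Nat.card G / m * (m - 1)))) := by
  refine ⟨fun hA => ⟨fun m hm => two_dvd_of_dvd_exponent hA (Nat.dvd_of_mem_divisors hm), ?_⟩,
    two_nsmul_regularChar_mem_AG, ?_⟩
  · obtain ⟨θ, h1, h2⟩ := exists_intToRat_eq_theta (K := K) (regularChar G)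
      (fun m => Nat.card G / m * (m - 1) / 2) fun s => by
        -- The exponent uses truncated division by $2$; it agrees with the rational pairing because
        -- $\rho_G \in A_G$ makes the numerator even.
        rw [pairing_regularChar, Nat.cast_div (two_dvd_of_regularChar_mem_AG hA s) two_ne_zero]
        rfl
    exact ⟨θ, h1, apply_eq_ideleIncl_prod S hS h θ _ h2⟩
  · obtain ⟨θ, h1, h2⟩ := exists_intToRat_eq_theta (K := K) (2 • regularChar G)
      (fun m => Nat.card G / m * (m - 1)) fun s => pairing_two_nsmul_regularChar s
    exact ⟨θ, h1, apply_eq_ideleIncl_prod S hS h θ _ h2⟩
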